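/- All logarithms are to base $2$, except that $\log_{t}p=\log p/\log t$. For a finite set $A$ in an abelian group and $k\ge 1$ let $kA=\{a_1+\dots+a_k: a_i\in A\}$ and $$\mathsf T_k^+(A)=\left|\{(a_1,\dots,a_k,a_1',\dots,a_k')\in A^{2k}: a_1+\dots+a_k=a_1'+\dots+a_k'\}\right|.$$ Let $\varphi$ be Euler's totient function. There is an absolute constant $C_*>0$ such that for every odd prime $p$, every multiplicative subgroup $\Gamma\le\mathbb F_p^*$, with $t=|\Gamma|$, and every integer $k\ge 2$: 1. if $3\le t\le \frac{\log p}{\log\log p}$, then $$\mathsf T_k^+(\Gamma)\le t^{k}\left(C_*\,k\,\log^2 t\cdot\log\log t\right)^k;$$ 2. if $t\ge\log p$, then $$\mathsf T_k^+(\Gamma)\le t^{2k}\left(\frac{C_*\,k\,\log t\cdot \max\{1,\log(\log_t p)\}^2}{\log p}\right)^k$$ (in particular, if also $t\le\sqrt p$, the maximum is simply $\log(\log_t p)$); 3. if $\frac{\log p}{\log\log p}\le t\le\log p$, then $$\mathsf T_k^+(\Gamma)\le t^{2k}\left(\frac{C_*\,k\,\log^2(\log p)}{\min\left\{\varphi(t),\frac{\log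 p}{\log\log p}\right\}}\right)^k.$$ Moreover, if $|\Gamma|\sim\log p$, then $|k\Gamma|=\Omega\left(\left(\frac{|\Gamma|}{k\log^3|\Gamma|}\right)^k\right)$; that is, for all reals $a,b>0$ there is a constant $c=c(a,b)>0$ such that for every prime $p$, every subgroup $\Gamma\le\mathbb F_p^*$ with $|\Gamma|\ge2$ and $a\log p\le|\Gamma|\le b\log p$, and every integer $k\ge1$, $$|k\Gamma|\ge c\left(\frac{|\Gamma|}{k\log^3|\Gamma|}\right)^k.$$ -/

import Mathlib

/-- The set of residues mod `p` that underlies a multiplicative subgroup of `𝔽_p^*`. -/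
def residueSet {p : ℕ} (Γ : Subgroup (ZMod p)ˣ) : Set (ZMod p) :=
  {x | ∃ u ∈ Γ, (u : ZMod p) = x}

/-- The additive energy `T_k^+(A)`: the number of `2k`-tuples
`(a_1, …, a_k, a'_1, …, a'_k)` of elements of `A` with `a_1 + ⋯ + a_k = a'_1 + ⋯ + a'_k`. -/
noncomputable def additiveEnergy {G : Type*} [AddCommGroup G] (k : ℕ) (A : Set G) : ℕ :=
  Set.ncard {x : (Fin k → G) × (Fin k → G) |
    (∀ i, x.1 i ∈ A) ∧ (∀ i, x.2 i ∈ A) ∧ ∑ i, x.1 i = ∑ i, x.2 i}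

/-- The `k`-fold sumset `kA = A + ⋯ + A`. -/
def kSumset {G : Type*} [AddCommGroup G] (k : ℕ) (A : Set G) : Set G :=
  {s | ∃ a : Fin k → G, (∀ i, a i ∈ A) ∧ s = ∑ i, a i}

/-- Logarithm to base `2`. -/
noncomputable def lg (x : ℝ) : ℝ := Real.logb 2 x

/-! Everything follows from one bound: Γ contains a dissociated set Λ of size d with 1/d ≤ 3 lg t /
lg p + 1/φ(t), and the energy is at most t^(2k) (24k/d)^k.

Size of Λ. Let Λ be a maximal dissociated subset of Γ = ⟨u⟩; every power of u is then a combination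
of Λ with coefficients in {-1, 0, 1}. If d were too small, simultaneous approximation would give x ≠
0 making all of xΛ small mod p, hence the whole orbit x u^i small. But u is a root mod p of an
integer polynomial c ≠ 0 of degree below φ(t) with coefficients of size about p^(1/φ(t)). Small
representatives r_i of x u^i satisfy the resulting recurrence over ℤ, not just mod p. In Fourier
terms c(ζ) R(ζ⁻¹) = 0, where R = ∑ r_i X^i and ζ is a primitive t-th root of unity. Since deg c <
φ(t), c(ζ) ≠ 0, so the cyclotomic polynomial Φ_t divides R; reducing mod p at u⁻¹ gives x t = 0,
which is absurd (`not_small_orbit`).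

Energy. Rudin's inequality bounds the 2k-th moment of the exponential sum over Λ. The sum over Γ is
an average of dilates of that sum by Γ, so it inherits the bound
(`additiveEnergy_le_of_isDissociated`).

The three ranges only compare lg t / lg p with 1/φ(t), using t ≤ φ(t)(lg t + 1); sumset growth is
Cauchy–Schwarz. -/

/-! ### Integer relations and the absence of small orbits -/

open Polynomial in
/-- Pigeonhole: powers of `u` satisfy an integer relation with few terms of small height. -/
theorem exists_small_relation {p : ℕ} [Fact p.Prime] (u : ZMod p) {h n : ℕ} (hp : p < h ^ n) :
    ∃ c : ℤ[X], c ≠ 0 ∧ c.degree < n ∧ (∀ i, |c.coeff i| ≤ (h : ℤ) - 1) ∧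
      ∑ i ∈ Finset.range n, (c.coeff i : ZMod p) * u ^ i = 0 := by
  classical
  let F : (Fin n → Fin h) → ZMod p := fun a => ∑ i, ((a i : ℕ) : ZMod p) * u ^ (i : ℕ)
  obtain ⟨a, b, hab, hF⟩ := Fintype.exists_ne_map_eq_of_card_lt F (by simpa [ZMod.card] using hp)
  let f : ℕ → ℤ := fun i => if hi : i < n then ((a ⟨i, hi⟩ : ℕ) : ℤ) - ((b ⟨i, hi⟩ : ℕ) : ℤ) else 0
  have hcoeff : ∀ i, (∑ j ∈ Finset.range n, C (f j) * X ^ j : ℤ[X]).coeff i = f i := by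
    intro i
    simp only [finsetSum_coeff, coeff_C_mul, coeff_X_pow, mul_ite, mul_one, mul_zero,
      Finset.sum_ite_eq, Finset.mem_range]
    by_cases hi : i < n <;> simp [f, hi]
  refine ⟨∑ j ∈ Finset.range n, C (f j) * X ^ j, ?_, ?_, ?_, ?_⟩
  · intro h0
    apply hab
    ext i
    have := hcoeff i
    rw [h0] at this
    simp [f] at this
    omega
  · rw [degree_lt_iff_coeff_zero]
    intro m hm
    rw [hcoeff]
    simp [f, not_lt.mpr hm]
  · intro i
    rw [hcoeff]
    have h1 : 1 ≤ h := by
      rcases Nat.eq_zero_or_pos h with rfl | h1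
      · rcases Nat.eq_zero_or_pos n with rfl | hn
        · have := (Fact.out : p.Prime).two_le
          simp at hp; omega
        · rw [zero_pow hn.ne'] at hp; omega
      · exact h1
    by_cases hi : i < n
    · simp only [f, hi, dif_pos]
      have := (a ⟨i, hi⟩).2
      have := (b ⟨i, hi⟩).2
      rw [abs_le]; constructor <;> omega
    · simp only [f, hi, dif_neg, not_false_eq_true, abs_zero]
      omega
  · have : ∀ i ∈ Finset.range n, ((∑ j ∈ Finset.range n, C (f j) * X ^ j : ℤ[X]).coeff i : ZMod p) *
        u ^ i = (f i : ZMod p) * u ^ i := fun i _ => by rw [hcoeff]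
    rw [Finset.sum_congr rfl this, Finset.sum_range]
    have h2 := sub_eq_zero.mpr hF
    simp only [F, ← Finset.sum_sub_distrib, ← sub_mul] at h2
    rw [← h2]
    refine Finset.sum_congr rfl fun i _ => ?_
    simp [f]

theorem Function.Periodic.sum_range_add {M : Type*} [AddCommMonoid M] {f : ℕ → M} {t : ℕ}
    (hf : Function.Periodic f t) (j : ℕ) :
    ∑ i ∈ Finset.range t, f (i + j) = ∑ i ∈ Finset.range t, f i := by
  induction j with
  | zero => simp
  | succ j ih =>
    rw [← ih]
    have h1 := Finset.sum_range_succ (fun i => f (i + j)) t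
    have h2 := Finset.sum_range_succ' (fun i => f (i + j)) t
    have h3 : f (t + j) = f (0 + j) := by rw [add_comm, hf, zero_add]
    cases t with
    | zero => simp
    | succ t =>
      rw [Finset.sum_range_succ, Finset.sum_range_succ' (fun i => f (i + j))]
      rw [show t + (j + 1) = t + 1 + j by ring, h3]
      congr 1
      exact Finset.sum_congr rfl fun i _ => by congr 1; ring

open Polynomial in
/-- A residue orbit `x * u ^ i` cannot have integer representatives that are all small. -/
theorem not_small_orbit {p : ℕ} [Fact p.Prime] {u : ZMod p} {t : ℕ} (ht : 0 < t)
    (hu : IsPrimitiveRoot u t) {h n : ℕ} (hn : n ≤ t.totient) (hp : p < h ^ n)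
    {x : ZMod p} (hx : x ≠ 0) (r : ZMod p → ℤ) (hr : ∀ i : ℕ, (r (u ^ i) : ZMod p) = x * u ^ i)
    (hsmall : ∀ i : ℕ, n * h * |r (u ^ i)| < p) : False := by
  have hpp := (Fact.out : p.Prime)
  obtain ⟨c, hc0, hcdeg, hcb, hcu⟩ := exists_small_relation u hp
  have hper : Function.Periodic (fun i : ℕ => r (u ^ i)) t := fun i => by
    simp only [pow_add, hu.pow_eq_one, mul_one]
  -- The relation lifts from mod p to ℤ: the sum is divisible by p and has absolute value below p.
  have hrec : ∀ i : ℕ, ∑ j ∈ Finset.range n, c.coeff j * r (u ^ (i + j)) = 0 := by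
    intro i
    have hdvd : (p : ℤ) ∣ ∑ j ∈ Finset.range n, c.coeff j * r (u ^ (i + j)) := by
      rw [← ZMod.intCast_zmod_eq_zero_iff_dvd, Int.cast_sum]
      have : ∀ j ∈ Finset.range n, ((c.coeff j * r (u ^ (i + j)) : ℤ) : ZMod p) =
          x * u ^ i * ((c.coeff j : ZMod p) * u ^ j) := by
        intro j _
        rw [Int.cast_mul, hr, pow_add]; ring
      rw [Finset.sum_congr rfl this, ← Finset.mul_sum, hcu, mul_zero]
    refine Int.eq_zero_of_abs_lt_dvd hdvd ?_
    rcases Nat.eq_zero_or_pos n with rfl | hn0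
    · simpa using hpp.pos
    have hle : (n : ℤ) * |∑ j ∈ Finset.range n, c.coeff j * r (u ^ (i + j))| ≤ n * (p - 1) := by
      calc (n : ℤ) * |∑ j ∈ Finset.range n, c.coeff j * r (u ^ (i + j))|
          ≤ n * ∑ j ∈ Finset.range n, |c.coeff j * r (u ^ (i + j))| := by
            gcongr; exact Finset.abs_sum_le_sum_abs _ _
        _ = ∑ j ∈ Finset.range n, n * (|c.coeff j| * |r (u ^ (i + j))|) := by
            rw [Finset.mul_sum]; simp only [abs_mul]
        _ ≤ ∑ j ∈ Finset.range n, ((p : ℤ) - 1) := by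
            refine Finset.sum_le_sum fun j _ => ?_
            have h1 := hcb j
            have h2 := hsmall (i + j)
            have h3 : |c.coeff j| * |r (u ^ (i + j))| ≤ h * |r (u ^ (i + j))| := by
              gcongr; omega
            have h4 : (n : ℤ) * (|c.coeff j| * |r (u ^ (i + j))|) ≤
              n * (h * |r (u ^ (i + j))|) := by gcongr
            rw [← mul_assoc] at h4 ⊢
            rw [← mul_assoc] at h4
            linarith
        _ = n * (p - 1) := by rw [Finset.sum_const, Finset.card_range, nsmul_eq_mul]
    have := le_of_mul_le_mul_left hle (by exact_mod_cast hn0)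
    omega
  obtain ⟨ζ, hζ⟩ : ∃ ζ : ℂ, IsPrimitiveRoot ζ t := ⟨_, Complex.isPrimitiveRoot_exp t ht.ne'⟩
  have hζ0 : ζ ≠ 0 := hζ.ne_zero ht.ne'
  have hcζ : aeval ζ c ≠ 0 := by
    intro h0
    have hdvd : cyclotomic t ℤ ∣ c := by
      rw [cyclotomic_eq_minpoly hζ ht]
      exact minpoly.isIntegrallyClosed_dvd (hζ.isIntegral ht) h0
    have h1 := degree_le_of_dvd hdvd hc0
    rw [degree_cyclotomic] at h1
    have h2 := lt_of_le_of_lt h1 hcdeg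
    rw [Nat.cast_lt] at h2
    omega
  have hcev : aeval ζ c = ∑ j ∈ Finset.range n, (c.coeff j : ℂ) * ζ ^ j := by
    have hcn : c.natDegree < n := by rwa [natDegree_lt_iff_degree_lt hc0]
    rw [aeval_eq_sum_range' hcn]
    simp
  let R : ℤ[X] := ∑ i ∈ Finset.range t, C (r (u ^ i)) * X ^ i
  have hRζ : aeval ζ⁻¹ R = 0 := by
    have hRev : aeval ζ⁻¹ R = ∑ i ∈ Finset.range t, (r (u ^ i) : ℂ) * ζ⁻¹ ^ i := by
      simp [R]
    -- The recurrence is a cyclic convolution equal to zero, so its transform, a product, vanishes.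
    have hmul : aeval ζ c * aeval ζ⁻¹ R = 0 := by
      rw [hcev, hRev, Finset.sum_mul]
      have hshift : ∀ j ∈ Finset.range n, (c.coeff j : ℂ) * ζ ^ j *
          ∑ i ∈ Finset.range t, (r (u ^ i) : ℂ) * ζ⁻¹ ^ i =
          ∑ i ∈ Finset.range t, ζ⁻¹ ^ i * ((c.coeff j * r (u ^ (i + j)) : ℤ) : ℂ) := by
        intro j _
        have hp2 : Function.Periodic (fun i : ℕ => (r (u ^ i) : ℂ) * ζ⁻¹ ^ i) t := fun i => by
          have h1 : r (u ^ (i + t)) = r (u ^ i) := hper i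
          simp only [h1, pow_add ζ⁻¹, hζ.inv.pow_eq_one, mul_one]
        rw [← hp2.sum_range_add j, Finset.mul_sum]
        refine Finset.sum_congr rfl fun i _ => ?_
        have h2 : ζ ^ j * ζ⁻¹ ^ j = 1 := by rw [← mul_pow, mul_inv_cancel₀ hζ0, one_pow]
        rw [pow_add ζ⁻¹]
        push_cast
        linear_combination (c.coeff j : ℂ) * r (u ^ (i + j)) * ζ⁻¹ ^ i * h2
      rw [Finset.sum_congr rfl hshift, Finset.sum_comm]
      refine Finset.sum_eq_zero fun i _ => ?_
      rw [← Finset.mul_sum, ← Int.cast_sum, hrec, Int.cast_zero, mul_zero]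
    exact (mul_eq_zero.mp hmul).resolve_left hcζ
  have hdvd : cyclotomic t ℤ ∣ R := by
    rw [cyclotomic_eq_minpoly hζ.inv ht]
    exact minpoly.isIntegrallyClosed_dvd (hζ.inv.isIntegral ht) hRζ
  have hu0 : u ≠ 0 := hu.ne_zero ht.ne'
  have : NeZero t := ⟨ht.ne'⟩
  -- A primitive t-th root of unity in a field forces the characteristic not to divide t.
  have htp : (t : ZMod p) ≠ 0 := (hu.neZero' ).out
  obtain ⟨Q, hQ⟩ := hdvd
  have h0 : aeval u⁻¹ R = 0 := by
    have : NeZero (t : ZMod p) := ⟨htp⟩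
    have : (cyclotomic t (ZMod p)).IsRoot u⁻¹ := isRoot_cyclotomic_iff.mpr hu.inv
    rw [hQ, map_mul]
    have h2 : aeval u⁻¹ (cyclotomic t ℤ) = 0 := by
      rw [← map_cyclotomic_int t (ZMod p), IsRoot, eval_map] at this
      exact this
    rw [h2, zero_mul]
  have h1 : aeval u⁻¹ R = x * t := by
    simp only [R, map_sum, map_mul, map_pow, aeval_X, eq_intCast, map_intCast, hr]
    have : ∀ i ∈ Finset.range t, x * u ^ i * u⁻¹ ^ i = x := fun i _ => by
      rw [mul_assoc, ← mul_pow, mul_inv_cancel₀ hu0, one_pow, mul_one]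
    rw [Finset.sum_congr rfl this]
    simp [mul_comm]
  exact mul_ne_zero hx htp (h1.symm.trans h0)

/-! ### Simultaneous approximation and dissociated spanning sets -/

/-- Simultaneous approximation modulo a prime. -/
theorem exists_multiplier_small {p : ℕ} [Fact p.Prime] (Λ : Finset (ZMod p)) {M : ℕ}
    (hM : M ^ Λ.card < p) :
    ∃ x : ZMod p, x ≠ 0 ∧ ∃ ρ : ZMod p → ℤ,
      ∀ a ∈ Λ, (ρ a : ZMod p) = x * a ∧ M * |ρ a| < p := by
  have hpp := (Fact.out : p.Prime)
  rcases Nat.eq_zero_or_pos M with rfl | hM0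
  · refine ⟨1, one_ne_zero, fun a => (a.val : ℤ), fun a _ => ⟨by simp, by simpa using hpp.pos⟩⟩
  -- Pigeonhole over M^|Λ| boxes of side p/M; the difference of two points in one box is the
  -- multiplier.
  let F : ZMod p → (Λ → Fin M) := fun x a => ⟨(x * a).val * M / p, by
    rw [Nat.div_lt_iff_lt_mul hpp.pos, mul_comm]
    exact Nat.mul_lt_mul_of_pos_left (ZMod.val_lt _) hM0⟩
  obtain ⟨x, y, hxy, hF⟩ := Fintype.exists_ne_map_eq_of_card_lt F (by simpa [ZMod.card] using hM)
  refine ⟨x - y, sub_ne_zero.mpr hxy, fun a => ((x * a).val : ℤ) - ((y * a).val : ℤ),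
    fun a ha => ⟨by simp [sub_mul], ?_⟩⟩
  have h1 : (x * a).val * M / p = (y * a).val * M / p := by
    have := congrFun hF ⟨a, ha⟩
    simpa [F] using this
  have h2 := Nat.div_add_mod ((x * a).val * M) p
  have h3 := Nat.div_add_mod ((y * a).val * M) p
  have h4 := Nat.mod_lt ((x * a).val * M) hpp.pos
  have h5 := Nat.mod_lt ((y * a).val * M) hpp.pos
  rw [h1] at h2
  rw [← Nat.abs_cast M, ← abs_mul, abs_lt, mul_sub]
  set q := (y * a).val * M / p
  zify at h2 h3 h4 h5
  have h6 : (0 : ℤ) ≤ (((x * a).val * M % p : ℕ) : ℤ) := Nat.cast_nonneg _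
  have h7 : (0 : ℤ) ≤ (((y * a).val * M % p : ℕ) : ℤ) := Nat.cast_nonneg _
  push_cast at h6 h7
  constructor <;> linarith

/-- A finite set with no nontrivial relation with coefficients in `{-1, 0, 1}`. -/
def IsDissociated {G : Type*} [AddCommGroup G] (Λ : Finset G) : Prop :=
  ∀ ε : G → ℤ, (∀ a ∈ Λ, |ε a| ≤ 1) → ∑ a ∈ Λ, ε a • a = 0 → ∀ a ∈ Λ, ε a = 0

/-- Take Λ of maximal size. Adjoining g creates a relation in which g has coefficient ±1, since
coefficient 0 would contradict dissociativity of Λ; solve for g. -/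
theorem exists_isDissociated_spanning {G : Type*} [AddCommGroup G] (A : Finset G) :
    ∃ Λ ⊆ A, IsDissociated Λ ∧
      ∀ g ∈ A, ∃ ε : G → ℤ, (∀ a ∈ Λ, |ε a| ≤ 1) ∧ g = ∑ a ∈ Λ, ε a • a := by
  classical
  have hne : (A.powerset.filter IsDissociated).Nonempty :=
    ⟨∅, by simp [IsDissociated]⟩
  obtain ⟨Λ, hΛ, hmax⟩ := Finset.exists_max_image _ Finset.card hne
  rw [Finset.mem_filter, Finset.mem_powerset] at hΛ
  refine ⟨Λ, hΛ.1, hΛ.2, fun g hg => ?_⟩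
  by_cases hgΛ : g ∈ Λ
  · refine ⟨fun a => if a = g then 1 else 0, fun a _ => by dsimp only; split_ifs <;> simp, ?_⟩
    simp [hgΛ]
  have hnot : ¬ IsDissociated (insert g Λ) := fun hd => by
    have := hmax (insert g Λ) (by
      rw [Finset.mem_filter, Finset.mem_powerset]
      exact ⟨Finset.insert_subset hg hΛ.1, hd⟩)
    rw [Finset.card_insert_of_notMem hgΛ] at this
    omega
  unfold IsDissociated at hnot
  push Not at hnot
  obtain ⟨ε, hε, hsum, b, hb, hb0⟩ := hnot
  rw [Finset.sum_insert hgΛ] at hsum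
  have hε' : ∀ a ∈ Λ, |ε a| ≤ 1 := fun a ha => hε a (Finset.mem_insert_of_mem ha)
  have hg1 := hε g (Finset.mem_insert_self _ _)
  rw [abs_le] at hg1
  have hcases : ε g = -1 ∨ ε g = 0 ∨ ε g = 1 := by omega
  rcases hcases with h | h | h
  · refine ⟨ε, hε', ?_⟩
    rw [h, neg_one_zsmul] at hsum
    exact (neg_add_eq_zero.mp hsum)
  · rw [h, zero_zsmul, zero_add] at hsum
    rcases Finset.mem_insert.mp hb with rfl | hb
    · exact absurd h hb0
    · exact absurd (hΛ.2 ε hε' hsum b hb) hb0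
  · refine ⟨fun a => - ε a, fun a ha => by simpa using hε' a ha, ?_⟩
    rw [h, one_zsmul] at hsum
    simp only [neg_smul, Finset.sum_neg_distrib]
    exact eq_neg_of_add_eq_zero_left hsum

/-- Otherwise `exists_multiplier_small` applies with M = φ(t) h |Λ|; summing at most |Λ| small terms
yields an orbit forbidden by `not_small_orbit`. -/
theorem prime_le_of_spanning {p : ℕ} [Fact p.Prime] {u : ZMod p} {t : ℕ} (ht : 0 < t)
    (hu : IsPrimitiveRoot u t) {h : ℕ} (hp : p < h ^ t.totient) (Λ : Finset (ZMod p))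
    (hΛ : ∀ i : ℕ, ∃ ε : ZMod p → ℤ, (∀ a ∈ Λ, |ε a| ≤ 1) ∧ u ^ i = ∑ a ∈ Λ, ε a • a) :
    p ≤ (t.totient * h * Λ.card) ^ Λ.card := by
  classical
  by_contra! hlt
  obtain ⟨x, hx, ρ, hρ⟩ := exists_multiplier_small Λ hlt
  choose ε hε hsum using hΛ
  have hr : ∃ r : ZMod p → ℤ, ∀ i : ℕ, (r (u ^ i) : ZMod p) = x * u ^ i ∧
      t.totient * h * |r (u ^ i)| < p := by
    have key : ∀ i : ℕ, ∃ m : ℤ, (m : ZMod p) = x * u ^ i ∧ t.totient * h * |m| < p := by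
      intro i
      refine ⟨∑ a ∈ Λ, ε i a * ρ a, ?_, ?_⟩
      · push_cast
        rw [hsum i, Finset.mul_sum]
        refine Finset.sum_congr rfl fun a ha => ?_
        rw [(hρ a ha).1, zsmul_eq_mul]; ring
      · rcases Finset.eq_empty_or_nonempty Λ with rfl | hne
        · simpa using (Fact.out : p.Prime).pos
        have hd : (0 : ℤ) < Λ.card := by exact_mod_cast hne.card_pos
        refine lt_of_mul_lt_mul_left ?_ hd.le
        calc (Λ.card : ℤ) * (t.totient * h * |∑ a ∈ Λ, ε i a * ρ a|)
            ≤ Λ.card * (t.totient * h * ∑ a ∈ Λ, |ρ a|) := by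
              gcongr
              refine (Finset.abs_sum_le_sum_abs _ _).trans (Finset.sum_le_sum fun a ha => ?_)
              rw [abs_mul]
              exact mul_le_of_le_one_left (abs_nonneg _) (hε i a ha)
          _ = ∑ a ∈ Λ, ((t.totient * h * Λ.card : ℕ) : ℤ) * |ρ a| := by
              rw [← Finset.mul_sum]; push_cast; ring
          _ < ∑ a ∈ Λ, (p : ℤ) := Finset.sum_lt_sum_of_nonempty hne fun a ha => (hρ a ha).2
          _ = Λ.card * p := by simp
    choose m hm using key
    -- Representatives must depend on the residue rather than the exponent, which makes them
    -- periodic in i.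
    refine ⟨fun y => if hy : ∃ i : ℕ, u ^ i = y then m hy.choose else 0, fun i => ?_⟩
    have hy : ∃ j : ℕ, u ^ j = u ^ i := ⟨i, rfl⟩
    simp only [hy, dif_pos]
    have := hm hy.choose
    rwa [hy.choose_spec] at this
  obtain ⟨r, hr⟩ := hr
  exact not_small_orbit ht hu le_rfl hp hx r (fun i => (hr i).1) (fun i => (hr i).2)

/-! ### Riesz products and Rudin's inequality -/

theorem map_sum_eq_prod_addChar {ι G M : Type*} [AddCommMonoid G] [CommMonoid M] (ψ : AddChar G M)
    (f : ι → G) (s : Finset ι) : ψ (∑ i ∈ s, f i) = ∏ i ∈ s, ψ (f i) := by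
  classical
  induction s using Finset.induction_on with
  | empty => simp
  | insert a s ha ih => rw [Finset.sum_insert ha, Finset.prod_insert ha, AddChar.map_add_eq_mul, ih]

theorem sum_stdAddChar_mul {p : ℕ} [Fact p.Prime] (b : ZMod p) :
    ∑ x : ZMod p, ZMod.stdAddChar (x * b) = if b = 0 then (p : ℂ) else 0 := by
  have := AddChar.sum_mulShift b (ZMod.isPrimitive_stdAddChar p)
  simpa [ZMod.card] using this

/-- The mean of a Riesz product over a dissociated set is the product of the constant terms. -/
theorem IsDissociated.sum_prod {p : ℕ} [Fact p.Prime] {Λ : Finset (ZMod p)}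
    (hΛ : IsDissociated Λ) (W : ℤ → ℂ) :
    ∑ x : ZMod p, ∏ a ∈ Λ, ∑ e ∈ ({-1, 0, 1} : Finset ℤ), W e * ZMod.stdAddChar (x * ((e : ZMod p) * a)) =
      p * W 0 ^ Λ.card := by
  classical
  have hexp : ∀ x : ZMod p,
      ∏ a ∈ Λ, ∑ e ∈ ({-1, 0, 1} : Finset ℤ), W e * ZMod.stdAddChar (x * ((e : ZMod p) * a)) =
      ∑ ε ∈ Fintype.piFinset fun _ : Λ => ({-1, 0, 1} : Finset ℤ),
        (∏ a, W (ε a)) * ZMod.stdAddChar (x * ∑ a : Λ, (ε a : ZMod p) * a) := by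
    intro x
    rw [← Finset.prod_coe_sort, Finset.prod_univ_sum]
    refine Finset.sum_congr rfl fun ε _ => ?_
    rw [Finset.prod_mul_distrib, Finset.mul_sum, map_sum_eq_prod_addChar]
  simp_rw [hexp]
  rw [Finset.sum_comm]
  simp_rw [← Finset.mul_sum, sum_stdAddChar_mul]
  rw [Finset.sum_eq_single (fun _ => 0)]
  · simp [mul_comm]
  · intro ε hε hne
    rw [if_neg, mul_zero]
    intro h0
    apply hne
    rw [Fintype.mem_piFinset] at hε
    have key := hΛ (fun a => if ha : a ∈ Λ then ε ⟨a, ha⟩ else 0) (fun a ha => by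
      have := hε ⟨a, ha⟩
      simp only [Finset.mem_insert, Finset.mem_singleton] at this
      simp only [ha, dif_pos]
      rcases this with h | h | h <;> simp [h]) (by
      rw [← h0, ← Finset.sum_coe_sort]
      exact Finset.sum_congr rfl fun a _ => by simp)
    funext a
    simpa using key a a.2
  · intro h
    exact absurd (by simp [Fintype.mem_piFinset]) h

/-- By convexity exp(θy) ≤ cosh θ + y sinh θ on [-1, 1]. The resulting product is a Riesz product
with constant terms cosh θ ≤ exp(θ²/2). -/
theorem IsDissociated.sum_exp_re_le {p : ℕ} [Fact p.Prime] {Λ : Finset (ZMod p)}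
    (hΛ : IsDissociated Λ) {w : ℂ} (hw : ‖w‖ = 1) (θ : ℝ) :
    ∑ x : ZMod p, Real.exp (θ * (w * ∑ a ∈ Λ, ZMod.stdAddChar (x * a)).re) ≤
      p * Real.exp (θ ^ 2 * Λ.card / 2) := by
  have hnorm : ∀ y : ZMod p, ‖(ZMod.stdAddChar y : ℂ)‖ = 1 := fun y =>
    AddChar.norm_apply _ y
  have h1 : ∀ x : ZMod p, Real.exp (θ * (w * ∑ a ∈ Λ, ZMod.stdAddChar (x * a)).re) ≤
      ∏ a ∈ Λ, (Real.cosh θ + (w * ZMod.stdAddChar (x * a)).re * Real.sinh θ) := by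
    intro x
    rw [Finset.mul_sum, Complex.re_sum, Finset.mul_sum, Real.exp_sum]
    refine Finset.prod_le_prod (fun _ _ => (Real.exp_pos _).le) fun a _ => ?_
    rw [mul_comm θ]
    refine Real.exp_mul_le_cosh_add_mul_sinh ?_ θ
    refine (Complex.abs_re_le_norm _).trans ?_
    rw [norm_mul, hw, hnorm, one_mul]
  let W : ℤ → ℂ := fun e => if e = 0 then (Real.cosh θ : ℂ) else
    if e = 1 then w * Real.sinh θ / 2 else (starRingEnd ℂ) w * Real.sinh θ / 2
  have h2 : ∀ x : ZMod p,
      ((∏ a ∈ Λ, (Real.cosh θ + (w * ZMod.stdAddChar (x * a)).re * Real.sinh θ) : ℝ) : ℂ) =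
      ∏ a ∈ Λ, ∑ e ∈ ({-1, 0, 1} : Finset ℤ), W e * ZMod.stdAddChar (x * ((e : ZMod p) * a)) := by
    intro x
    rw [Complex.ofReal_prod]
    refine Finset.prod_congr rfl fun a _ => ?_
    rw [Finset.sum_insert (by decide), Finset.sum_insert (by decide), Finset.sum_singleton]
    have hneg : (ZMod.stdAddChar (x * (((-1 : ℤ) : ZMod p) * a)) : ℂ) =
        (starRingEnd ℂ) (ZMod.stdAddChar (x * a)) := by
      rw [← AddChar.map_neg_eq_conj]; congr 1; push_cast; ring
    rw [hneg]
    have hre : (((w * ZMod.stdAddChar (x * a)).re : ℝ) : ℂ) =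
        (w * ZMod.stdAddChar (x * a) + (starRingEnd ℂ) (w * ZMod.stdAddChar (x * a))) / 2 :=
      Complex.re_eq_add_conj _
    push_cast [hre]
    simp [W]
    ring
  have h3 := hΛ.sum_prod W
  simp_rw [← h2] at h3
  have h4 : ∑ x : ZMod p, ∏ a ∈ Λ, (Real.cosh θ + (w * ZMod.stdAddChar (x * a)).re * Real.sinh θ) =
      p * Real.cosh θ ^ Λ.card := by
    have : W 0 = (Real.cosh θ : ℂ) := by simp [W]
    rw [this] at h3
    exact_mod_cast h3
  refine (Finset.sum_le_sum fun x _ => h1 x).trans ?_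
  rw [h4]
  gcongr
  calc Real.cosh θ ^ Λ.card ≤ Real.exp (θ ^ 2 / 2) ^ Λ.card := by
        exact pow_le_pow_left₀ (Real.cosh_pos θ).le (Real.cosh_le_exp_half_sq θ) _
    _ = Real.exp (θ ^ 2 * Λ.card / 2) := by rw [← Real.exp_nat_mul]; congr 1; ring

theorem IsDissociated.sum_re_pow_le {p : ℕ} [Fact p.Prime] {Λ : Finset (ZMod p)}
    (hΛ : IsDissociated Λ) (hne : Λ.Nonempty) {w : ℂ} (hw : ‖w‖ = 1) {k : ℕ} (hk : 1 ≤ k) :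
    ∑ x : ZMod p, ((w * ∑ a ∈ Λ, ZMod.stdAddChar (x * a)).re) ^ (2 * k) ≤
      2 * p * (6 * k * Λ.card) ^ k := by
  set d : ℝ := (Λ.card : ℝ) with hd
  have hd0 : 0 < d := by rw [hd]; exact_mod_cast hne.card_pos
  have hk0 : (0 : ℝ) < k := by exact_mod_cast hk
  -- Chosen so that the exponent θ² d / 2 equals k.
  set θ : ℝ := Real.sqrt (2 * k / d) with hθ
  have hθ2 : θ ^ 2 = 2 * k / d := Real.sq_sqrt (by positivity)
  have hpt : ∀ y : ℝ, y ^ (2 * k) * θ ^ (2 * k) ≤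
      (2 * k).factorial * (Real.exp (θ * y) + Real.exp (-θ * y)) := by
    intro y
    have h1 := Real.pow_div_factorial_le_exp (x := |θ * y|) (abs_nonneg _) (2 * k)
    rw [(even_two_mul k).pow_abs, div_le_iff₀ (by positivity)] at h1
    have h2 : Real.exp |θ * y| ≤ Real.exp (θ * y) + Real.exp (-θ * y) := by
      rw [neg_mul]
      rcases abs_cases (θ * y) with ⟨h, _⟩ | ⟨h, _⟩ <;> rw [h]
      · linarith [Real.exp_pos (-(θ * y))]
      · linarith [Real.exp_pos (θ * y)]
    calc y ^ (2 * k) * θ ^ (2 * k) = (θ * y) ^ (2 * k) := by rw [mul_pow]; ring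
      _ ≤ _ := h1
      _ ≤ (Real.exp (θ * y) + Real.exp (-θ * y)) * (2 * k).factorial := by gcongr
      _ = _ := mul_comm _ _
  have hsum := Finset.sum_le_sum fun (x : ZMod p) (_ : x ∈ Finset.univ) =>
    hpt (w * ∑ a ∈ Λ, ZMod.stdAddChar (x * a)).re
  rw [← Finset.sum_mul, ← Finset.mul_sum, Finset.sum_add_distrib] at hsum
  have e1 := hΛ.sum_exp_re_le hw θ
  have e2 := hΛ.sum_exp_re_le hw (-θ)
  rw [neg_sq] at e2
  have hexp : θ ^ 2 * d / 2 = k := by rw [hθ2]; field_simp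
  rw [← hd, hexp] at e1 e2
  set T := ∑ x : ZMod p, ((w * ∑ a ∈ Λ, ZMod.stdAddChar (x * a)).re) ^ (2 * k)
  have hfac : ((2 * k).factorial : ℝ) ≤ (2 * k) ^ (2 * k) := by
    exact_mod_cast Nat.factorial_le_pow (2 * k)
  have hek : Real.exp k ≤ 3 ^ k := by
    rw [← mul_one (k : ℝ), Real.exp_nat_mul]
    gcongr
    linarith [Real.exp_one_lt_d9]
  have hmain : T * θ ^ (2 * k) ≤ (2 * k) ^ (2 * k) * (2 * (p * 3 ^ k)) := by
    refine hsum.trans ?_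
    have : (p : ℝ) * Real.exp k ≤ p * 3 ^ k := by gcongr
    gcongr
    linarith
  have hθk : θ ^ (2 * k) = (2 * k / d) ^ k := by rw [pow_mul, hθ2]
  rw [hθk] at hmain
  have hpos : 0 < (2 * (k : ℝ) / d) ^ k := by positivity
  refine le_of_mul_le_mul_right (hmain.trans (le_of_eq ?_)) hpos
  rw [mul_assoc (2 * (p : ℝ)), ← mul_pow, pow_mul (2 * (k : ℝ)),
    show 6 * (k : ℝ) * d * (2 * k / d) = (2 * k) ^ 2 * 3 by field_simp; norm_num,
    mul_pow ((2 * (k : ℝ)) ^ 2) 3]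
  ring

/-- Rudin's inequality for dissociated sets. -/
theorem IsDissociated.sum_norm_pow_le {p : ℕ} [Fact p.Prime] {Λ : Finset (ZMod p)}
    (hΛ : IsDissociated Λ) (hne : Λ.Nonempty) {k : ℕ} (hk : 1 ≤ k) :
    ∑ x : ZMod p, ‖∑ a ∈ Λ, (ZMod.stdAddChar (x * a) : ℂ)‖ ^ (2 * k) ≤
      p * (24 * k * Λ.card) ^ k := by
  -- The weights 1 and -i pick out the real and imaginary parts.
  have hpt : ∀ z : ℂ, ‖z‖ ^ (2 * k) ≤
      2 ^ (k - 1) * ((1 * z).re ^ (2 * k) + (-Complex.I * z).re ^ (2 * k)) := by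
    intro z
    rw [pow_mul, ← Complex.normSq_eq_norm_sq, Complex.normSq_apply]
    have := add_pow_le (mul_self_nonneg z.re) (mul_self_nonneg z.im) k
    simpa [pow_mul, ← sq] using this
  have h1 := hΛ.sum_re_pow_le hne (w := 1) (by simp) hk
  have h2 := hΛ.sum_re_pow_le hne (w := -Complex.I) (by simp) hk
  calc _ ≤ ∑ x : ZMod p, 2 ^ (k - 1) *
          ((1 * ∑ a ∈ Λ, (ZMod.stdAddChar (x * a) : ℂ)).re ^ (2 * k) +
          (-Complex.I * ∑ a ∈ Λ, (ZMod.stdAddChar (x * a) : ℂ)).re ^ (2 * k)) :=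
        Finset.sum_le_sum fun x _ => hpt _
    _ ≤ 2 ^ (k - 1) * (2 * p * (6 * k * Λ.card) ^ k + 2 * p * (6 * k * Λ.card) ^ k) := by
        rw [← Finset.mul_sum, Finset.sum_add_distrib]
        gcongr
    _ = 2 ^ k * 2 * (p * (6 * k * Λ.card) ^ k) := by
        obtain ⟨m, rfl⟩ : ∃ m, k = m + 1 := ⟨k - 1, by omega⟩
        rw [Nat.add_sub_cancel, pow_succ 2]; ring
    _ ≤ 2 ^ k * 2 ^ k * (p * (6 * k * Λ.card) ^ k) := by
        gcongr
        exact le_self_pow₀ (by norm_num) (by omega)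
    _ = p * (24 * k * Λ.card) ^ k := by
        rw [show 24 * (k : ℝ) * Λ.card = 2 * 2 * (6 * k * Λ.card) by ring, mul_pow (2 * 2),
          mul_pow 2 2]
        ring

/-! ### Additive energy as a moment of exponential sums -/

theorem card_mul_additiveEnergy {p : ℕ} [Fact p.Prime] (A : Finset (ZMod p)) (k : ℕ) :
    (p : ℝ) * additiveEnergy k (A : Set (ZMod p)) =
      ∑ x : ZMod p, ‖∑ a ∈ A, (ZMod.stdAddChar (x * a) : ℂ)‖ ^ (2 * k) := by
  classical
  set P := Fintype.piFinset fun _ : Fin k => A with hP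
  have hcard : additiveEnergy k (A : Set (ZMod p)) =
      ((P ×ˢ P).filter fun x => ∑ i, x.1 i = ∑ i, x.2 i).card := by
    rw [additiveEnergy, ← Set.ncard_coe_finset]
    congr 1
    ext x
    simp [hP, and_assoc]
  have hpow : ∀ x : ZMod p, ((‖∑ a ∈ A, (ZMod.stdAddChar (x * a) : ℂ)‖ ^ (2 * k) : ℝ) : ℂ) =
      ∑ y ∈ P ×ˢ P, ZMod.stdAddChar (x * (∑ i, y.1 i - ∑ i, y.2 i)) := by
    intro x
    have hS : (∑ a ∈ A, (ZMod.stdAddChar (x * a) : ℂ)) ^ k =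
        ∑ y ∈ P, ZMod.stdAddChar (x * ∑ i, y i) := by
      rw [Finset.sum_pow']
      refine Finset.sum_congr rfl fun y _ => ?_
      rw [Finset.mul_sum, map_sum_eq_prod_addChar]
    rw [pow_mul, ← Complex.normSq_eq_norm_sq, Complex.ofReal_pow, ← Complex.mul_conj, mul_pow,
      ← map_pow, hS, map_sum, Finset.sum_mul_sum, Finset.sum_product]
    refine Finset.sum_congr rfl fun y _ => Finset.sum_congr rfl fun z _ => ?_
    rw [← AddChar.map_neg_eq_conj, ← AddChar.map_add_eq_mul]
    congr 1; ring
  have : ((p : ℝ) * additiveEnergy k (A : Set (ZMod p)) : ℂ) =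
      ∑ x : ZMod p, ((‖∑ a ∈ A, (ZMod.stdAddChar (x * a) : ℂ)‖ ^ (2 * k) : ℝ) : ℂ) := by
    simp_rw [hpow]
    rw [Finset.sum_comm]
    simp_rw [sum_stdAddChar_mul, sub_eq_zero]
    rw [← Finset.sum_filter, Finset.sum_const, hcard, nsmul_eq_mul]
    push_cast; ring
  exact_mod_cast this

/-- The energy of a multiplicative subgroup is controlled by any dissociated subset. -/
theorem additiveEnergy_le_of_isDissociated {p : ℕ} [Fact p.Prime] (Γ : Subgroup (ZMod p)ˣ)
    {A Λ : Finset (ZMod p)} (hA : (A : Set (ZMod p)) = residueSet Γ) (hΛA : Λ ⊆ A)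
    (hΛ : IsDissociated Λ) (hne : Λ.Nonempty) {k : ℕ} (hk : 1 ≤ k) :
    (additiveEnergy k (residueSet Γ) : ℝ) ≤ (A.card : ℝ) ^ (2 * k) * (24 * k / Λ.card) ^ k := by
  have hpp := (Fact.out : p.Prime)
  have hp0 : (0 : ℝ) < p := by exact_mod_cast hpp.pos
  have hd0 : (0 : ℝ) < Λ.card := by exact_mod_cast hne.card_pos
  have hmem : ∀ y, y ∈ A ↔ ∃ u ∈ Γ, ((u : (ZMod p)ˣ) : ZMod p) = y := fun y => by
    rw [← Finset.mem_coe, hA]; rfl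
  have hne0 : ∀ y ∈ A, y ≠ 0 := fun y hy => by
    obtain ⟨u, _, rfl⟩ := (hmem y).1 hy; exact u.ne_zero
  set f : ZMod p → ℂ := fun x => ∑ a ∈ Λ, (ZMod.stdAddChar (x * a) : ℂ)
  set S : ZMod p → ℂ := fun x => ∑ a ∈ A, (ZMod.stdAddChar (x * a) : ℂ) with hS
  -- Each a ∈ Λ lies in Γ, so multiplication by a permutes Γ.
  have hSf : ∀ x, (Λ.card : ℂ) * S x = ∑ g ∈ A, f (x * g) := by
    intro x
    rw [Finset.sum_comm]
    have : ∀ a ∈ Λ, ∑ g ∈ A, (ZMod.stdAddChar (x * g * a) : ℂ) = S x := by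
      intro a ha
      have haA := hΛA ha
      obtain ⟨v, hv, rfl⟩ := (hmem a).1 haA
      refine Finset.sum_bij (fun g _ => g * v) ?_ ?_ ?_ ?_
      · intro g hg
        obtain ⟨u, hu, rfl⟩ := (hmem g).1 hg
        exact (hmem _).2 ⟨u * v, mul_mem hu hv, by simp⟩
      · intro g _ g' _ h
        exact mul_right_cancel₀ v.ne_zero h
      · intro b hb
        obtain ⟨u, hu, rfl⟩ := (hmem b).1 hb
        exact ⟨_, (hmem _).2 ⟨u * v⁻¹, mul_mem hu (inv_mem hv), rfl⟩, by rw [← Units.val_mul, inv_mul_cancel_right]⟩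
      · intro g _
        rw [mul_assoc]
    rw [Finset.sum_congr rfl this]
    simp
  obtain ⟨m, hm⟩ : ∃ m, 2 * k = m + 1 := ⟨2 * k - 1, by omega⟩
  have hA0 : (0 : ℝ) < A.card := by exact_mod_cast (hne.mono hΛA).card_pos
  have hpt : ∀ x, (Λ.card : ℝ) ^ (2 * k) * ‖S x‖ ^ (2 * k) ≤
      (A.card : ℝ) ^ m * ∑ g ∈ A, ‖f (x * g)‖ ^ (2 * k) := by
    intro x
    have h1 : (Λ.card : ℝ) * ‖S x‖ ≤ ∑ g ∈ A, ‖f (x * g)‖ := by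
      have : (Λ.card : ℝ) * ‖S x‖ = ‖(Λ.card : ℂ) * S x‖ := by simp
      rw [this, hSf]
      exact norm_sum_le _ _
    have h2 := pow_sum_div_card_le_sum_pow (s := A) (f := fun g => ‖f (x * g)‖)
      (fun _ _ => norm_nonneg _) m
    rw [div_le_iff₀ (by positivity), ← hm] at h2
    rw [← mul_pow, mul_comm ((A.card : ℝ) ^ m)]
    exact (pow_le_pow_left₀ (by positivity) h1 _).trans h2
  have hshift : ∀ g ∈ A, ∑ x, ‖f (x * g)‖ ^ (2 * k) = ∑ x, ‖f x‖ ^ (2 * k) := fun g hg =>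
    Fintype.sum_equiv (Equiv.mulRight₀ g (hne0 g hg)) _ _ fun x => rfl
  have hE := card_mul_additiveEnergy A k
  rw [hA] at hE
  have hsum : (Λ.card : ℝ) ^ (2 * k) * ((p : ℝ) * additiveEnergy k (residueSet Γ)) ≤
      (A.card : ℝ) ^ (2 * k) * (p * (24 * k * Λ.card) ^ k) := by
    rw [hE, Finset.mul_sum]
    refine (Finset.sum_le_sum fun x _ => hpt x).trans ?_
    rw [← Finset.mul_sum, Finset.sum_comm, Finset.sum_congr rfl hshift, Finset.sum_const,
      nsmul_eq_mul, ← mul_assoc, ← pow_succ, ← hm]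
    gcongr
    exact hΛ.sum_norm_pow_le hne hk
  have hpos : (0 : ℝ) < (Λ.card : ℝ) ^ (2 * k) * p := by positivity
  refine le_of_mul_le_mul_left ?_ hpos
  rw [mul_assoc]
  refine hsum.trans (le_of_eq ?_)
  have : (24 * (k : ℝ) * Λ.card) ^ k = (Λ.card : ℝ) ^ (2 * k) * (24 * k / Λ.card) ^ k := by
    rw [pow_mul, ← mul_pow]
    congr 1
    field_simp
  rw [this]; ring

/-! ### Totient and logarithm estimates -/

/-- The i-th smallest element is at least i + 1, so the product dominates the telescoping ∏ i/(i+1).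
-/
theorem one_le_card_add_one_mul_prod (S : Finset ℕ) (hS : ∀ q ∈ S, 2 ≤ q) :
    1 ≤ ((S.card : ℝ) + 1) * ∏ q ∈ S, (1 - (q : ℝ)⁻¹) := by
  induction S using Finset.induction_on_max with
  | empty => simp
  | insert M S hM ih =>
    have hnot : M ∉ S := fun h => (hM M h).false
    have ih := ih fun q hq => hS q (Finset.mem_insert_of_mem hq)
    have hcard : S.card + 2 ≤ M := by
      have hsub : S ⊆ Finset.Ico 2 M := fun q hq =>
        Finset.mem_Ico.2 ⟨hS q (Finset.mem_insert_of_mem hq), hM q hq⟩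
      have := Finset.card_le_card hsub
      have h2 := hS M (Finset.mem_insert_self _ _)
      rw [Nat.card_Ico] at this
      omega
    rw [Finset.prod_insert hnot, Finset.card_insert_of_notMem hnot]
    have hMr : (S.card : ℝ) + 2 ≤ M := by exact_mod_cast hcard
    have hc : (0 : ℝ) ≤ S.card := Nat.cast_nonneg _
    have hM0 : (0 : ℝ) < M := by linarith
    have hP : 0 ≤ ∏ q ∈ S, (1 - (q : ℝ)⁻¹) := Finset.prod_nonneg fun q hq => by
      have : (1 : ℝ) ≤ q := by
        have := hS q (Finset.mem_insert_of_mem hq)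
        exact_mod_cast (by omega : 1 ≤ q)
      have := inv_le_one_of_one_le₀ this
      linarith
    have hkey : (S.card : ℝ) + 1 ≤ ((S.card + 1 : ℕ) + 1) * (1 - (M : ℝ)⁻¹) := by
      have : ((S.card : ℝ) + 2) * (M : ℝ)⁻¹ ≤ 1 := by
        rw [← div_eq_mul_inv]; exact (div_le_one hM0).2 hMr
      push_cast
      linarith
    calc (1 : ℝ) ≤ (S.card + 1) * ∏ q ∈ S, (1 - (q : ℝ)⁻¹) := ih
      _ ≤ ((S.card + 1 : ℕ) + 1) * (1 - (M : ℝ)⁻¹) * ∏ q ∈ S, (1 - (q : ℝ)⁻¹) := by gcongr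
      _ = _ := by ring

theorem le_totient_mul_lg {t : ℕ} (ht : 0 < t) : (t : ℝ) ≤ t.totient * (lg t + 1) := by
  have h1 := one_le_card_add_one_mul_prod t.primeFactors fun q hq =>
    (Nat.prime_of_mem_primeFactors hq).two_le
  have h2 : (t.totient : ℝ) = t * ∏ q ∈ t.primeFactors, (1 - (q : ℝ)⁻¹) := by
    have := congrArg (Rat.cast : ℚ → ℝ) (Nat.totient_eq_mul_prod_factors t)
    push_cast at this
    exact this
  have ht0 : (0 : ℝ) < t := by exact_mod_cast ht
  have h3 : (t.primeFactors.card : ℝ) ≤ lg t := by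
    have h4 : 2 ^ t.primeFactors.card ≤ t := by
      refine le_trans ?_ (Nat.le_of_dvd ht (Nat.prod_primeFactors_dvd t))
      exact Finset.pow_card_le_prod _ _ _ fun q hq => (Nat.prime_of_mem_primeFactors hq).two_le
    rw [lg, Real.le_logb_iff_rpow_le (by norm_num) ht0, Real.rpow_natCast]
    exact_mod_cast h4
  calc (t : ℝ) = t * 1 := (mul_one _).symm
    _ ≤ t * ((t.primeFactors.card + 1) * ∏ q ∈ t.primeFactors, (1 - (q : ℝ)⁻¹)) := by gcongr
    _ = t.totient * (t.primeFactors.card + 1) := by rw [h2]; ring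
    _ ≤ _ := by gcongr

theorem lg_mul {x y : ℝ} (hx : 0 < x) (hy : 0 < y) : lg (x * y) = lg x + lg y :=
  Real.logb_mul hx.ne' hy.ne'

theorem lg_pow (x : ℝ) (n : ℕ) : lg (x ^ n) = n * lg x := Real.logb_pow _ _ _

theorem lg_mono {x y : ℝ} (hx : 0 < x) (hxy : x ≤ y) : lg x ≤ lg y :=
  Real.logb_le_logb_of_le (by norm_num) hx hxy

theorem lg_two : lg 2 = 1 := Real.logb_self_eq_one (by norm_num)

theorem one_le_lg {x : ℝ} (hx : 2 ≤ x) : 1 ≤ lg x := lg_two ▸ lg_mono (by norm_num) hx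

theorem exists_isPrimitiveRoot_residueSet {p : ℕ} [Fact p.Prime] (Γ : Subgroup (ZMod p)ˣ) :
    ∃ u : ZMod p, IsPrimitiveRoot u (Nat.card Γ) ∧ ∀ i : ℕ, u ^ i ∈ residueSet Γ := by
  obtain ⟨g, hg⟩ := IsCyclic.exists_generator (α := Γ)
  have hord : orderOf g = Nat.card Γ := orderOf_eq_card_of_forall_mem_zpowers hg
  refine ⟨((g : (ZMod p)ˣ) : ZMod p), ?_, fun i => ⟨(g : (ZMod p)ˣ) ^ i, pow_mem g.2 i, by simp⟩⟩
  rw [← hord]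
  have h := IsPrimitiveRoot.orderOf ((g : (ZMod p)ˣ) : ZMod p)
  rwa [orderOf_units, Subgroup.orderOf_coe] at h

theorem card_toFinset_residueSet {p : ℕ} [Fact p.Prime] (Γ : Subgroup (ZMod p)ˣ) :
    (residueSet Γ).toFinite.toFinset.card = Nat.card Γ := by
  rw [← Set.ncard_eq_toFinset_card]
  have : residueSet Γ = (fun v : (ZMod p)ˣ => (v : ZMod p)) '' (Γ : Set (ZMod p)ˣ) := rfl
  rw [this, Set.ncard_image_of_injective _ Units.val_injective]
  rfl

/-! ### The main energy bound and Cauchy–Schwarz for sumsets -/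

/-- A subgroup contains a large dissociated set, and its additive energy is bounded accordingly. -/
theorem exists_additiveEnergy_le {p : ℕ} [Fact p.Prime] (Γ : Subgroup (ZMod p)ˣ)
    (ht : 2 ≤ Nat.card Γ) :
    ∃ D : ℝ, 0 < D ∧ 1 / D ≤ 3 * lg (Nat.card Γ) / lg p + 1 / (Nat.card Γ).totient ∧
      ∀ k : ℕ, 1 ≤ k → (additiveEnergy k (residueSet Γ) : ℝ) ≤
        (Nat.card Γ : ℝ) ^ (2 * k) * (24 * k / D) ^ k := by
  classical
  set t := Nat.card Γ with ht_def
  have hpp := (Fact.out : p.Prime)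
  obtain ⟨u, hu, humem⟩ := exists_isPrimitiveRoot_residueSet Γ
  set A : Finset (ZMod p) := (residueSet Γ).toFinite.toFinset
  have hA : (A : Set (ZMod p)) = residueSet Γ := Set.Finite.coe_toFinset _
  have hAcard : A.card = t := card_toFinset_residueSet Γ
  obtain ⟨Λ, hΛA, hΛ, hspan⟩ := exists_isDissociated_spanning A
  have hspan' : ∀ i : ℕ, ∃ ε : ZMod p → ℤ, (∀ a ∈ Λ, |ε a| ≤ 1) ∧ u ^ i = ∑ a ∈ Λ, ε a • a :=
    fun i => hspan _ (by rw [← Finset.mem_coe, hA]; exact humem i)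
  have hne : Λ.Nonempty := by
    by_contra h
    rw [Finset.not_nonempty_iff_eq_empty] at h
    obtain ⟨ε, -, h1⟩ := hspan' 0
    simp [h] at h1
  have hd : Λ.card ≤ t := hAcard ▸ Finset.card_le_card hΛA
  have hn : 0 < t.totient := Nat.totient_pos.2 (by omega)
  have hnt : t.totient ≤ t := Nat.totient_le t
  have hd0 : (0 : ℝ) < Λ.card := by exact_mod_cast hne.card_pos
  have hn0 : (0 : ℝ) < t.totient := by exact_mod_cast hn
  have hp1 : (1 : ℝ) < p := by exact_mod_cast hpp.one_lt
  have ht0 : (0 : ℝ) < t := by exact_mod_cast (by omega : 0 < t)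
  have hL : 0 < lg p := Real.logb_pos (by norm_num) hp1
  have hlt : 1 ≤ lg t := one_le_lg (by exact_mod_cast ht)
  refine ⟨Λ.card, hd0, ?_, fun k hk => ?_⟩
  · set y : ℝ := (p : ℝ) ^ ((t.totient : ℝ)⁻¹) with hy
    have hy1 : 1 ≤ y := Real.one_le_rpow hp1.le (by positivity)
    have hyn : y ^ t.totient = p := by
      rw [hy, ← Real.rpow_natCast, ← Real.rpow_mul (by linarith), inv_mul_cancel₀ hn0.ne',
        Real.rpow_one]
    -- The least integer with h^φ(t) > p; it is at most 2y, and that 2 is later absorbed by t ≥ 2.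
    set h : ℕ := ⌊y⌋₊ + 1 with hh
    have hh1 : y < h := by rw [hh]; exact_mod_cast Nat.lt_floor_add_one y
    have hh2 : (h : ℝ) ≤ 2 * y := by
      rw [hh]; push_cast
      have := Nat.floor_le (by linarith : 0 ≤ y)
      linarith
    have hph : p < h ^ t.totient := by
      have : (p : ℝ) < (h : ℝ) ^ t.totient := by
        rw [← hyn]; exact pow_lt_pow_left₀ hh1 (by linarith) hn.ne'
      exact_mod_cast this
    have hmain := prime_le_of_spanning (by omega) hu hph Λ hspan'
    have hmain' : (p : ℝ) ≤ ((t : ℝ) ^ 3 * y) ^ Λ.card := by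
      have h1 : (p : ℝ) ≤ (t.totient * h * Λ.card) ^ Λ.card := by exact_mod_cast hmain
      refine h1.trans ?_
      have h2 : (t.totient : ℝ) ≤ t := by exact_mod_cast hnt
      have h3 : (Λ.card : ℝ) ≤ t := by exact_mod_cast hd
      have h4 : (2 : ℝ) ≤ t := by exact_mod_cast ht
      refine pow_le_pow_left₀ (by positivity) ?_ _
      calc (t.totient : ℝ) * h * Λ.card ≤ t * (2 * y) * t := by gcongr
        _ = t * t * 2 * y := by ring
        _ ≤ t * t * t * y := by gcongr
        _ = t ^ 3 * y := by ring
    have hlg := lg_mono (by linarith) hmain'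
    have hly : lg y = lg p / t.totient := by
      rw [hy, lg, Real.logb_rpow_eq_mul_logb_of_pos (by linarith), lg, div_eq_inv_mul]
    rw [lg_pow, lg_mul (by positivity) (by linarith), lg_pow, hly] at hlg
    rw [div_le_iff₀ hd0]
    have : (1 : ℝ) = lg p / lg p := (div_self hL.ne').symm
    rw [this, div_le_iff₀ hL]
    refine hlg.trans (le_of_eq ?_)
    field_simp
    push_cast
    ring
  · have := additiveEnergy_le_of_isDissociated Γ hA hΛA hΛ hne hk
    rwa [hAcard] at this

/-- Cauchy–Schwarz on the representation counts of the sums, whose squares add up to the energy. -/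
theorem card_pow_le_ncard_kSumset_mul {p : ℕ} [Fact p.Prime] (A : Finset (ZMod p)) (k : ℕ) :
    (A.card : ℝ) ^ (2 * k) ≤
      (kSumset k (A : Set (ZMod p))).ncard * additiveEnergy k (A : Set (ZMod p)) := by
  classical
  set P := Fintype.piFinset fun _ : Fin k => A with hP
  have hcard : additiveEnergy k (A : Set (ZMod p)) =
      ((P ×ˢ P).filter fun x => ∑ i, x.1 i = ∑ i, x.2 i).card := by
    rw [additiveEnergy, ← Set.ncard_coe_finset]
    congr 1
    ext x
    simp [hP, and_assoc]
  set B := P.image fun a => ∑ i, a i with hB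
  have hBcard : (kSumset k (A : Set (ZMod p))).ncard = B.card := by
    rw [← Set.ncard_coe_finset]
    congr 1
    ext s
    simp [kSumset, hB, hP, eq_comm]
  have h1 : A.card ^ k = ∑ s ∈ B, (P.filter fun a => ∑ i, a i = s).card := by
    rw [← Finset.card_eq_sum_card_image, hP, Fintype.card_piFinset_const]
  have h2 : additiveEnergy k (A : Set (ZMod p)) =
      ∑ s ∈ B, (P.filter fun a => ∑ i, a i = s).card ^ 2 := by
    rw [hcard, Finset.card_eq_sum_card_fiberwise (f := fun x => ∑ i, x.1 i) (t := B)]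
    · refine Finset.sum_congr rfl fun s _ => ?_
      rw [sq, ← Finset.card_product]
      congr 1
      ext x
      simp only [Finset.mem_filter, Finset.mem_product]
      constructor
      · rintro ⟨⟨⟨ha, hb⟩, h⟩, rfl⟩
        exact ⟨⟨ha, rfl⟩, hb, h.symm⟩
      · rintro ⟨⟨ha, h⟩, hb, h'⟩
        exact ⟨⟨⟨ha, hb⟩, h.trans h'.symm⟩, h⟩
    · intro x hx
      simp only [Finset.coe_filter, Finset.mem_product, Set.mem_ofPred_eq] at hx
      exact Finset.mem_coe.2 (Finset.mem_image_of_mem _ hx.1.1)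
  have h3 : (A.card ^ k) ^ 2 ≤ B.card * additiveEnergy k (A : Set (ZMod p)) := by
    rw [h1, h2]; exact sq_sum_le_card_mul_sum_sq
  rw [hBcard, mul_comm 2 k, pow_mul]
  exact_mod_cast h3

theorem pow_div_pow_le_exp {y : ℝ} (hy : 0 ≤ y) (k : ℕ) :
    (y / k) ^ k ≤ Real.exp y := by
  refine le_trans ?_ (Real.pow_div_factorial_le_exp y hy k)
  rw [div_pow]
  gcongr
  exact_mod_cast Nat.factorial_le_pow k

theorem lg_lt_self {y : ℝ} (hy : 0 < y) : lg y < y := by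
  have h2 : (0 : ℝ) < Real.log 2 := Real.log_pos (by norm_num)
  have h1 := Real.log_le_sub_one_of_pos (half_pos hy)
  rw [Real.log_div hy.ne' (by norm_num)] at h1
  rw [lg, Real.logb, div_lt_iff₀ h2]
  have h3 := Real.log_two_gt_d9
  have h4 := Real.log_two_lt_d9
  nlinarith

theorem three_halves_le_lg {x : ℝ} (hx : 3 ≤ x) : 3 / 2 ≤ lg x := by
  have h := lg_mono (x := 2 ^ 3) (y := x ^ 2) (by norm_num) (by nlinarith)
  rw [lg_pow, lg_pow, lg_two] at h
  push_cast at h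
  linarith

theorem half_le_lg_lg {x : ℝ} (hx : 3 ≤ x) : 1 / 2 ≤ lg (lg x) := by
  have h3 := three_halves_le_lg hx
  have h := lg_mono (x := 2) (y := lg x ^ 2) (by norm_num) (by nlinarith)
  rw [lg_pow, lg_two] at h
  push_cast at h
  linarith

theorem one_div_totient_le {t : ℕ} (ht : 2 ≤ t) : 1 / (t.totient : ℝ) ≤ 2 * lg t / t := by
  have ht0 : (0 : ℝ) < t := by exact_mod_cast (by omega : 0 < t)
  have hn0 : (0 : ℝ) < t.totient := by exact_mod_cast Nat.totient_pos.2 (by omega)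
  have h1 := le_totient_mul_lg (by omega : 0 < t)
  have h2 : 1 ≤ lg t := one_le_lg (by exact_mod_cast ht)
  rw [div_le_div_iff₀ hn0 ht0]
  nlinarith

/-! ### The three size ranges and sumset growth -/

theorem additiveEnergy_le_very_small {p : ℕ} [Fact p.Prime] (hp : 3 ≤ p) (Γ : Subgroup (ZMod p)ˣ)
    {k : ℕ} (hk : 1 ≤ k) (ht : 3 ≤ Nat.card Γ) (htp : (Nat.card Γ : ℝ) ≤ lg p / lg (lg p)) :
    (additiveEnergy k (residueSet Γ) : ℝ) ≤ (Nat.card Γ : ℝ) ^ k *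
      (400 * k * lg (Nat.card Γ) ^ 2 * lg (lg (Nat.card Γ))) ^ k := by
  obtain ⟨D, hD, hDle, hE⟩ := exists_additiveEnergy_le Γ (by omega)
  have hφ := one_div_totient_le (by omega : 2 ≤ Nat.card Γ)
  set t : ℕ := Nat.card Γ
  have ht3 : (3 : ℝ) ≤ t := by exact_mod_cast ht
  have hp3 : (3 : ℝ) ≤ p := by exact_mod_cast hp
  have hlt := three_halves_le_lg ht3
  have hllt := half_le_lg_lg ht3
  have hlp := three_halves_le_lg hp3
  have hllp := half_le_lg_lg hp3
  have ht0 : (0 : ℝ) < t := by linarith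
  have h1 : 3 * lg t / lg p ≤ 6 * lg t / t := by
    rw [le_div_iff₀ (by linarith)] at htp
    rw [div_le_div_iff₀ (by linarith) ht0]
    have : (t : ℝ) / 2 ≤ lg p := by nlinarith
    nlinarith
  have h2 : 1 / D ≤ 8 * lg t / t := by
    calc 1 / D ≤ 6 * lg t / t + 2 * lg t / t := by linarith
      _ = 8 * lg t / t := by ring
  have h3 : 8 * lg t ≤ 400 / 24 * (lg t ^ 2 * lg (lg t)) := by
    have : 3 / 4 ≤ lg t * lg (lg t) := by nlinarith
    -- Here lg t · lg lg t ≥ 3/4, and 400/24 · 3/4 = 12.5 exceeds 8.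
    nlinarith
  refine (hE k hk).trans ?_
  rw [two_mul, pow_add, mul_assoc, ← mul_pow]
  refine mul_le_mul_of_nonneg_left (pow_le_pow_left₀ (by positivity) ?_ _) (by positivity)
  calc t * (24 * k / D) = 24 * k * (t * (1 / D)) := by ring
    _ ≤ 24 * k * (t * (8 * lg t / t)) := by gcongr
    _ = 24 * k * (8 * lg t) := by field_simp
    _ ≤ 24 * k * (400 / 24 * (lg t ^ 2 * lg (lg t))) := by gcongr
    _ = 400 * k * lg t ^ 2 * lg (lg t) := by ring

theorem additiveEnergy_le_of_lg_le {p : ℕ} [Fact p.Prime] (hp : 3 ≤ p) (Γ : Subgroup (ZMod p)ˣ)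
    {k : ℕ} (hk : 1 ≤ k) (htp : lg p ≤ (Nat.card Γ : ℝ)) :
    (additiveEnergy k (residueSet Γ) : ℝ) ≤ (Nat.card Γ : ℝ) ^ (2 * k) *
      (400 * k * lg (Nat.card Γ) * max 1 (lg (Real.logb (Nat.card Γ) p)) ^ 2 / lg p) ^ k := by
  have hp3 : (3 : ℝ) ≤ p := by exact_mod_cast hp
  have hlp := three_halves_le_lg hp3
  have ht : 2 ≤ Nat.card Γ := by
    have : (1 : ℝ) < Nat.card Γ := by linarith
    exact_mod_cast this
  obtain ⟨D, hD, hDle, hE⟩ := exists_additiveEnergy_le Γ ht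
  have hφ := one_div_totient_le ht
  set t : ℕ := Nat.card Γ
  have hlt : 1 ≤ lg t := one_le_lg (by exact_mod_cast ht)
  set L : ℝ := max 1 (lg (Real.logb t p))
  have hL : 1 ≤ L ^ 2 := one_le_pow₀ (le_max_left _ _)
  -- This is already stronger than required: the factor L² ≥ 1 is simply given away below.
  have h2 : 1 / D ≤ 5 * lg t / lg p := by
    have : 2 * lg t / t ≤ 2 * lg t / lg p := by gcongr
    calc 1 / D ≤ 3 * lg t / lg p + 2 * lg t / lg p := by linarith
      _ = 5 * lg t / lg p := by ring
  refine (hE k hk).trans ?_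
  refine mul_le_mul_of_nonneg_left (pow_le_pow_left₀ (by positivity) ?_ _) (by positivity)
  calc 24 * k / D = 24 * k * (1 / D) := by ring
    _ ≤ 24 * k * (5 * lg t / lg p) := by gcongr
    _ = 120 * k * lg t * 1 / lg p := by ring
    _ ≤ 400 * k * lg t * L ^ 2 / lg p := by gcongr; norm_num

theorem additiveEnergy_le_intermediate {p : ℕ} [Fact p.Prime] (hp : 3 ≤ p)
    (Γ : Subgroup (ZMod p)ˣ) {k : ℕ} (hk : 1 ≤ k)
    (hlow : lg p / lg (lg p) ≤ (Nat.card Γ : ℝ)) (hup : (Nat.card Γ : ℝ) ≤ lg p) :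
    (additiveEnergy k (residueSet Γ) : ℝ) ≤ (Nat.card Γ : ℝ) ^ (2 * k) *
      (400 * k * lg (lg p) ^ 2 /
        min (Nat.totient (Nat.card Γ) : ℝ) (lg p / lg (lg p))) ^ k := by
  have hp3 : (3 : ℝ) ≤ p := by exact_mod_cast hp
  have hlp := three_halves_le_lg hp3
  have hllp := half_le_lg_lg hp3
  have ht : 2 ≤ Nat.card Γ := by
    have h1 : 1 < lg p / lg (lg p) := (one_lt_div (by linarith)).2 (lg_lt_self (by linarith))
    have : (1 : ℝ) < Nat.card Γ := by linarith
    exact_mod_cast this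
  obtain ⟨D, hD, hDle, hE⟩ := exists_additiveEnergy_le Γ ht
  set t : ℕ := Nat.card Γ
  have ht0 : (0 : ℝ) < t := by exact_mod_cast (by omega : 0 < t)
  have hn0 : (0 : ℝ) < t.totient := by exact_mod_cast Nat.totient_pos.2 (by omega)
  set m : ℝ := min (t.totient : ℝ) (lg p / lg (lg p))
  have hm0 : 0 < m := lt_min hn0 (by apply div_pos <;> linarith)
  have hlt : lg t ≤ lg (lg p) := lg_mono ht0 hup
  have h1 : 3 * lg t / lg p ≤ 3 / m := by
    calc 3 * lg t / lg p ≤ 3 * lg (lg p) / lg p := by gcongr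
      _ = 3 / (lg p / lg (lg p)) := by field_simp
      _ ≤ 3 / m := by gcongr; exact min_le_right _ _
  have h2 : 1 / (t.totient : ℝ) ≤ 1 / m := by gcongr; exact min_le_left _ _
  have h3 : 1 / D ≤ 4 / m := by
    calc 1 / D ≤ 3 / m + 1 / m := by linarith
      _ = 4 / m := by ring
  refine (hE k hk).trans ?_
  refine mul_le_mul_of_nonneg_left (pow_le_pow_left₀ (by positivity) ?_ _) (by positivity)
  calc 24 * k / D = 24 * k * (1 / D) := by ring
    _ ≤ 24 * k * (4 / m) := by gcongr
    _ = 400 * k * (24 / 100) / m := by ring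
    _ ≤ 400 * k * lg (lg p) ^ 2 / m := by gcongr; nlinarith

/-- The energy bound loses K^k with K depending on b. Once lg² t ≥ K, the spare logarithms in lg³ t
absorb it; otherwise t ≤ 2^K and the left side is bounded uniformly in k. -/
theorem le_ncard_kSumset {p : ℕ} [Fact p.Prime] (Γ : Subgroup (ZMod p)ˣ) {k : ℕ} (hk : 1 ≤ k)
    {b : ℝ} (hb : 0 < b) (ht : 2 ≤ Nat.card Γ) (hup : (Nat.card Γ : ℝ) ≤ b * lg p) :
    Real.exp (-2 ^ (24 * (3 * b + 2))) *
        ((Nat.card Γ : ℝ) / (k * lg (Nat.card Γ) ^ 3)) ^ k ≤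
      ((kSumset k (residueSet Γ)).ncard : ℝ) := by
  classical
  obtain ⟨D, hD, hDle, hE⟩ := exists_additiveEnergy_le Γ ht
  have hφ := one_div_totient_le ht
  have hN := card_pow_le_ncard_kSumset_mul (residueSet Γ).toFinite.toFinset k
  have hA : (((residueSet Γ).toFinite.toFinset : Finset (ZMod p)) : Set (ZMod p)) =
    residueSet Γ := Set.Finite.coe_toFinset _
  have hAcard : (residueSet Γ).toFinite.toFinset.card = Nat.card Γ := card_toFinset_residueSet Γ
  rw [hA, hAcard] at hN
  set t : ℕ := Nat.card Γ
  set N := (kSumset k (residueSet Γ)).ncard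
  set K : ℝ := 24 * (3 * b + 2) with hK
  have hk0 : (0 : ℝ) < k := by exact_mod_cast hk
  have ht0 : (0 : ℝ) < t := by exact_mod_cast (by omega : 0 < t)
  have hlt : 1 ≤ lg t := one_le_lg (by exact_mod_cast ht)
  have hlt0 : 0 < lg t := by linarith
  have hlp : 0 < lg p := by
    by_contra! h
    nlinarith
  have h1 : 3 * lg t / lg p ≤ 3 * b * lg t / t := by
    rw [div_le_div_iff₀ hlp ht0]
    nlinarith
  have h2 : 24 * k / D ≤ K * k * lg t / t := by
    calc 24 * k / D = 24 * k * (1 / D) := by ring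
      _ ≤ 24 * k * (3 * b * lg t / t + 2 * lg t / t) := by gcongr; linarith
      _ = K * k * lg t / t := by rw [hK]; ring
  have h3 : 1 ≤ N * (K * k * lg t / t) ^ k := by
    have hpos : (0 : ℝ) < (t : ℝ) ^ (2 * k) := by positivity
    refine le_of_mul_le_mul_left ?_ hpos
    calc (t : ℝ) ^ (2 * k) * 1 ≤ N * additiveEnergy k (residueSet Γ) := by rw [mul_one]; exact hN
      _ ≤ N * ((t : ℝ) ^ (2 * k) * (24 * k / D) ^ k) := by gcongr; exact hE k hk
      _ ≤ N * ((t : ℝ) ^ (2 * k) * (K * k * lg t / t) ^ k) := by gcongr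
      _ = (t : ℝ) ^ (2 * k) * (N * (K * k * lg t / t) ^ k) := by ring
  have hN1 : (1 : ℝ) ≤ N := by
    have : N ≠ 0 := by
      intro h
      rw [h] at h3
      norm_num at h3
    exact_mod_cast Nat.one_le_iff_ne_zero.2 this
  by_cases hc : K ≤ lg t ^ 2
  · have h4 : K * k * lg t / t ≤ k * lg t ^ 3 / t := by
      calc K * k * lg t / t ≤ lg t ^ 2 * k * lg t / t := by gcongr
        _ = k * lg t ^ 3 / t := by ring
    have h5 : (1 : ℝ) ≤ N * (k * lg t ^ 3 / t) ^ k := h3.trans (by gcongr)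
    have h6 : ((t : ℝ) / (k * lg t ^ 3)) ^ k ≤ N := by
      rw [← inv_div, inv_pow]
      exact (inv_le_iff_one_le_mul₀ (by positivity)).2 h5
    refine le_trans ?_ h6
    refine mul_le_of_le_one_left (by positivity) ?_
    rw [Real.exp_le_one_iff, neg_nonpos]
    positivity
  · have hltK : lg t ≤ K := by nlinarith
    have htK : (t : ℝ) ≤ 2 ^ K := (Real.logb_le_iff_le_rpow (by norm_num) ht0).1 hltK
    -- Uniformity in k comes from (t/k)^k ≤ e^t, which also explains the constant exp(-2^K).
    have h4 : ((t : ℝ) / (k * lg t ^ 3)) ^ k ≤ Real.exp (2 ^ K) := by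
      refine le_trans ?_ ((pow_div_pow_le_exp ht0.le k).trans (Real.exp_le_exp.2 htK))
      gcongr
      exact le_mul_of_one_le_right hk0.le (one_le_pow₀ hlt)
    calc _ ≤ Real.exp (-2 ^ K) * Real.exp (2 ^ K) := by gcongr
      _ = 1 := by rw [← Real.exp_add, neg_add_cancel, Real.exp_zero]
      _ ≤ N := hN1

theorem corollaryc :
    (∃ C : ℝ, 0 < C ∧
      ∀ (p : ℕ) [Fact p.Prime], 3 ≤ p → ∀ (Γ : Subgroup (ZMod p)ˣ) (k : ℕ), 2 ≤ k →
        -- very small subgroups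
        (3 ≤ Nat.card Γ → (Nat.card Γ : ℝ) ≤ lg p / lg (lg p) →
          (additiveEnergy k (residueSet Γ) : ℝ) ≤
            (Nat.card Γ : ℝ) ^ k *
              (C * k * lg (Nat.card Γ) ^ 2 * lg (lg (Nat.card Γ))) ^ k) ∧
        -- subgroups of size at least log p
        (lg p ≤ (Nat.card Γ : ℝ) →
          (additiveEnergy k (residueSet Γ) : ℝ) ≤
            (Nat.card Γ : ℝ) ^ (2 * k) *
              (C * k * lg (Nat.card Γ) * max 1 (lg (Real.logb (Nat.card Γ) p)) ^ 2
                / lg p) ^ k) ∧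
        -- the intermediate range
        (lg p / lg (lg p) ≤ (Nat.card Γ : ℝ) → (Nat.card Γ : ℝ) ≤ lg p →
          (additiveEnergy k (residueSet Γ) : ℝ) ≤
            (Nat.card Γ : ℝ) ^ (2 * k) *
              (C * k * lg (lg p) ^ 2
                / min (Nat.totient (Nat.card Γ) : ℝ) (lg p / lg (lg p))) ^ k)) ∧
    -- growth of the sumsets when |Γ| is comparable to log p
    (∀ a b : ℝ, 0 < a → 0 < b → ∃ c : ℝ, 0 < c ∧
      ∀ (p : ℕ) [Fact p.Prime] (Γ : Subgroup (ZMod p)ˣ) (k : ℕ), 1 ≤ k →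
        2 ≤ Nat.card Γ →
        a * lg p ≤ (Nat.card Γ : ℝ) → (Nat.card Γ : ℝ) ≤ b * lg p →
          c * ((Nat.card Γ : ℝ) / (k * lg (Nat.card Γ) ^ 3)) ^ k ≤
            ((kSumset k (residueSet Γ)).ncard : ℝ)) := by
  refine ⟨⟨400, by norm_num, fun p _ hp Γ k hk => ⟨?_, ?_, ?_⟩⟩, fun a b _ hb =>
    ⟨Real.exp (-2 ^ (24 * (3 * b + 2))), Real.exp_pos _, fun p _ Γ k hk ht _ hup =>
      le_ncard_kSumset Γ hk hb ht hup⟩⟩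
  · exact additiveEnergy_le_very_small hp Γ (by omega)
  · exact additiveEnergy_le_of_lg_le hp Γ (by omega)
  · exact additiveEnergy_le_intermediate hp Γ (by omega)
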